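/- Let $a<b$, $x_0\in(a,b)$ and $\sigma\ge 0$ be fixed. For $\theta>0$ consider the Ornstein–Uhlenbeck process $$dx=-\theta x\,dt+\sigma\sqrt{\theta}\,dw_t,\qquad x(0)=x_0,$$ where $w$ is a standard Brownian motion, and define its first passage time $\tau\in[0,\infty]$ (with $\inf\emptyset=\infty$) in one of the following three settings: 1. both thresholds absorbing: $\tau=\inf\{t\ge 0: x(t)\notin(a,b)\}$; 2. $a$ reflecting, $b$ absorbing: $\tau=\inf\{t\ge0: x(t)\ge b\}$, where $x$ is reflected at $a$, i.e. $x\ge a$ and $dx=-\theta x\,dt+\sigma\sqrt\theta\,dw_t+d\ell_t$ with $\ell$ continuous, nondecreasing, $\ell_0=0$, and increasing only at times when $x=a$; 3. $b$ reflecting, $a$ absorbing: $\tau=\inf\{t\ge0: x(t)\le a\}$, where $x$ is reflected at $b$, i.e. $x\le b$ and $dx=-\theta x\,dt+\sigma\sqrt\theta\,dw_t-d\ell_t$ with $\ell$ continuous, nondecreasing, $\ell_0=0$, and increasing only at times when $x=b$. Then in each setting the law $\nu$ of the rescaled time $\bar\tau=\theta\tau$ does not depend on $\theta$ (only on the setting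 and on $\sigma,a,b,x_0$). Hence for every integer $m\ge 0$ $$\mathbb E[\tau^m]=\theta^{-m}\,\mathbb E[\bar\tau^m]=\theta^{-m}\int t^m\,\nu(dt)\qquad\text{in }[0,\infty],$$ so that $\mathbb E[\tau^m]$ is proportional to $\theta^{-m}$, with a constant that does not depend on $\theta$. If $\sigma>0$, then $\tau<\infty$ almost surely, all moments $\mathbb E[\tau^m]$ are finite, $\mathbb E[\tau]>0$ and $\operatorname{Var}(\tau)>0$. The normalized moments $\mathbb E[\tau^m]/\mathbb E[\tau]^m$, the coefficient of variation $\sqrt{\operatorname{Var}(\tau)}/\mathbb E[\tau]$ and the standardized moments $\mathbb E[(\tau-\mathbb E\tau)^m]/\operatorname{Var}(\tau)^{m/2}$ (skewness for $m=3$, kurtosis for $m=4$) are equal to those of $\nu$, hence independent of $\theta$; here $\sigma>0$, or $\sigma=0$ and the quantity in question is defined. -/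

import Mathlib

open MeasureTheory ProbabilityTheory Set
open scoped ENNReal NNReal

universe u

/-- `X` solves `dX = -θ X dt + σ √θ dW`, `X 0 = x₀`, where `W` is a standard Brownian motion:
almost surely, `X` has continuous paths and satisfies the integral form of the equation. (The noise
is additive, so the stochastic integral `∫₀ᵗ σ √θ dW` is `σ √θ W t`.) -/
structure IsOUProcess {Ω : Type*} [MeasurableSpace Ω] (P : Measure Ω) (θ σ x₀ : ℝ)
    (W X : ℝ≥0 → Ω → ℝ) : Prop where
  brownian : IsBrownianReal W P
  continuous_paths : ∀ᵐ ω ∂P, Continuous fun t ↦ X t ω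
  equation : ∀ᵐ ω ∂P, ∀ t : ℝ≥0,
    X t ω = x₀ - θ * (∫ s in (0 : ℝ)..t, X s.toNNReal ω) + σ * √θ * W t ω

/-- `ℓ` is a regulator for the path `x` at the level `c`: it is continuous, nondecreasing, starts
at `0`, and increases only at times when `x` is at `c`, i.e. it is constant on every time interval
during which `x` stays away from `c`. -/
structure IsRegulator (c : ℝ) (x ℓ : ℝ≥0 → ℝ) : Prop where
  continuous : Continuous ℓ
  monotone : Monotone ℓ
  zero : ℓ 0 = 0
  flat : ∀ s t : ℝ≥0, s ≤ t → (∀ r ∈ Icc s t, x r ≠ c) → ℓ s = ℓ t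

/-- `X` is the process `dX = -θ X dt + σ √θ dW` started at `x₀` and reflected upwards at `a`
(Skorokhod equation): it stays in `[a, ∞)`, and the regulator `L` pushes it up at `a`. -/
structure IsLowerReflectedOUProcess {Ω : Type*} [MeasurableSpace Ω] (P : Measure Ω)
    (θ σ x₀ a : ℝ) (W X L : ℝ≥0 → Ω → ℝ) : Prop where
  brownian : IsBrownianReal W P
  continuous_paths : ∀ᵐ ω ∂P, Continuous fun t ↦ X t ω
  mem : ∀ᵐ ω ∂P, ∀ t : ℝ≥0, a ≤ X t ω
  regulator : ∀ᵐ ω ∂P, IsRegulator a (fun t ↦ X t ω) (fun t ↦ L t ω)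
  equation : ∀ᵐ ω ∂P, ∀ t : ℝ≥0,
    X t ω = x₀ - θ * (∫ s in (0 : ℝ)..t, X s.toNNReal ω) + σ * √θ * W t ω + L t ω

/-- `X` is the process `dX = -θ X dt + σ √θ dW` started at `x₀` and reflected downwards at `b`
(Skorokhod equation): it stays in `(-∞, b]`, and the regulator `L` pushes it down at `b`. -/
structure IsUpperReflectedOUProcess {Ω : Type*} [MeasurableSpace Ω] (P : Measure Ω)
    (θ σ x₀ b : ℝ) (W X L : ℝ≥0 → Ω → ℝ) : Prop where
  brownian : IsBrownianReal W P
  continuous_paths : ∀ᵐ ω ∂P, Continuous fun t ↦ X t ω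
  mem : ∀ᵐ ω ∂P, ∀ t : ℝ≥0, X t ω ≤ b
  regulator : ∀ᵐ ω ∂P, IsRegulator b (fun t ↦ X t ω) (fun t ↦ L t ω)
  equation : ∀ᵐ ω ∂P, ∀ t : ℝ≥0,
    X t ω = x₀ - θ * (∫ s in (0 : ℝ)..t, X s.toNNReal ω) + σ * √θ * W t ω - L t ω

/-- The first time at which `X` is outside `D`, with value `∞` if `X` never leaves `D`. -/
noncomputable def exitTime {Ω : Type*} (X : ℝ≥0 → Ω → ℝ) (D : Set ℝ) (ω : Ω) : ℝ≥0∞ :=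
  ⨅ (t : ℝ≥0) (_ : X t ω ∉ D), (t : ℝ≥0∞)

/-- The nature of the two thresholds `a < b`. -/
inductive Thresholds
  | bothAbsorbing
  | lowerReflecting
  | upperReflecting

/-- `τ` is the first passage time of the Ornstein–Uhlenbeck process with drift `θ` and relative
noise strength `σ`, started at `x₀`, between the thresholds `a` and `b`:
* both absorbing: the first time at which the process is outside `(a, b)`;
* `a` reflecting: the first time at which the process reflected at `a` is at or above `b`;
* `b` reflecting: the first time at which the process reflected at `b` is at or below `a`. -/
def IsOUFirstPassageTime {Ω : Type*} [MeasurableSpace Ω] (P : Measure Ω) (k : Thresholds)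
    (θ σ a b x₀ : ℝ) (τ : Ω → ℝ≥0∞) : Prop :=
  match k with
  | .bothAbsorbing => ∃ W X : ℝ≥0 → Ω → ℝ,
      IsOUProcess P θ σ x₀ W X ∧ τ = exitTime X (Ioo a b)
  | .lowerReflecting => ∃ W X L : ℝ≥0 → Ω → ℝ,
      IsLowerReflectedOUProcess P θ σ x₀ a W X L ∧ τ = exitTime X (Iio b)
  | .upperReflecting => ∃ W X L : ℝ≥0 → Ω → ℝ,
      IsUpperReflectedOUProcess P θ σ x₀ b W X L ∧ τ = exitTime X (Ioi a)

/-- The normalized moment `E[Y ^ m] / E[Y] ^ m`. -/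
noncomputable def normalizedMoment {Ω : Type*} [MeasurableSpace Ω] (P : Measure Ω) (Y : Ω → ℝ)
    (m : ℕ) : ℝ :=
  moment Y m P / (∫ ω, Y ω ∂P) ^ m

/-- The coefficient of variation: standard deviation divided by mean. -/
noncomputable def coeffVariation {Ω : Type*} [MeasurableSpace Ω] (P : Measure Ω) (Y : Ω → ℝ) : ℝ :=
  √(variance Y P) / ∫ ω, Y ω ∂P

/-- The standardized moment `E[(Y - E Y) ^ m] / (standard deviation) ^ m`; it is the skewness for
`m = 3` and the kurtosis for `m = 4`. -/
noncomputable def standardizedMoment {Ω : Type*} [MeasurableSpace Ω] (P : Measure Ω) (Y : Ω → ℝ)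
    (m : ℕ) : ℝ :=
  centralMoment Y m P / √(variance Y P) ^ m

/-! The noise is additive, so the equation can be solved path by path. In the time scale `θ t` it
has unit drift coefficient and is driven by `√θ W (t / θ)`, which is again a Brownian motion;
passage times are multiplied by `θ`. With unit drift, multiplication by `eᵗ` removes the drift, and
the solution becomes explicit in the driving path: variation of constants (`eq_ouPath`), combined
with Skorokhod's running maximum formula when there is reflection (`eq_reflectedOUPath`). Hence `θ
τ` is almost surely a fixed measurable functional of a Brownian path
(`exists_ae_eq_passageFunctional`). The law of Brownian motion on path space is unique
(`map_toPathSpace_eq`), so `θ` drops out of the law of `θ τ`, and the statistics follow by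
homogeneity.

For `σ > 0`, before passage the path is confined to `[a, b]`, which bounds the upward noise
increments. Over unit intervals these are independent Gaussians, so the tail of `τ` is geometric
(`exists_measure_lt_le`). A large increment over an arbitrarily short time also has positive
probability, so `τ` is not a positive constant (`variance_pos`). -/

/-! ### The Ornstein-Uhlenbeck equation along a path -/

/-- The integral `∫₀ᵗ eˢ dh(s)` (plus `h 0`), defined through integration by parts. -/
noncomputable def expStieltjes (h : ℝ≥0 → ℝ) (t : ℝ≥0) : ℝ :=
  Real.exp t * h t - ∫ s in (0 : ℝ)..t, Real.exp s * h s.toNNReal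

lemma continuous_comp_toNNReal {h : ℝ≥0 → ℝ} (hh : Continuous h) :
    Continuous fun s : ℝ ↦ h s.toNNReal :=
  hh.comp continuous_real_toNNReal

lemma continuous_exp_mul_comp_toNNReal {h : ℝ≥0 → ℝ} (hh : Continuous h) :
    Continuous fun s : ℝ ↦ Real.exp s * h s.toNNReal :=
  Real.continuous_exp.mul (continuous_comp_toNNReal hh)

lemma continuous_expStieltjes {h : ℝ≥0 → ℝ} (hh : Continuous h) :
    Continuous (expStieltjes h) := by
  have hi : Continuous fun t : ℝ ↦ ∫ s in (0 : ℝ)..t, Real.exp s * h s.toNNReal :=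
    intervalIntegral.continuous_primitive
      (fun _ _ ↦ (continuous_exp_mul_comp_toNNReal hh).intervalIntegrable _ _) 0
  have : Continuous fun t : ℝ≥0 ↦ ∫ s in (0 : ℝ)..t, Real.exp s * h s.toNNReal :=
    hi.comp NNReal.continuous_coe
  unfold expStieltjes
  fun_prop

lemma expStieltjes_const_mul_add {h k : ℝ≥0 → ℝ} (hh : Continuous h) (hk : Continuous k) (c : ℝ)
    (t : ℝ≥0) :
    expStieltjes (fun s ↦ c * h s + k s) t = c * expStieltjes h t + expStieltjes k t := by
  have h1 : ∀ s : ℝ, Real.exp s * (c * h s.toNNReal + k s.toNNReal)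
      = c * (Real.exp s * h s.toNNReal) + Real.exp s * k s.toNNReal := fun s ↦ by ring
  simp only [expStieltjes, h1]
  rw [intervalIntegral.integral_add, intervalIntegral.integral_const_mul]
  · ring
  · exact ((continuous_exp_mul_comp_toNNReal hh).const_mul c).intervalIntegrable _ _
  · exact (continuous_exp_mul_comp_toNNReal hk).intervalIntegrable _ _

lemma expStieltjes_sub {h : ℝ≥0 → ℝ} (hh : Continuous h) (s t : ℝ≥0) :
    expStieltjes h t - expStieltjes h s = Real.exp t * h t - Real.exp s * h s
      - ∫ r in (s : ℝ)..t, Real.exp r * h r.toNNReal := by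
  have hi (u v : ℝ) := (continuous_exp_mul_comp_toNNReal hh).intervalIntegrable (μ := volume) u v
  rw [← intervalIntegral.integral_interval_sub_left (hi 0 t) (hi 0 s)]
  simp only [expStieltjes]
  ring

/-- On `[s, t]` the integrand is at most `eʳ h t`, so the increment is at least `eˢ (h t - h s)`.
With the next lemma, this makes `∫ eˢ dℓ` a regulator whenever `ℓ` is one. -/
lemma expStieltjes_monotone {h : ℝ≥0 → ℝ} (hh : Continuous h) (hm : Monotone h) :
    Monotone (expStieltjes h) := by
  intro s t hst
  have hst' : (s : ℝ) ≤ t := hst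
  have h1 : ∫ r in (s : ℝ)..t, Real.exp r * h r.toNNReal
      ≤ ∫ r in (s : ℝ)..t, Real.exp r * h t := by
    refine intervalIntegral.integral_mono_on hst'
      ((continuous_exp_mul_comp_toNNReal hh).intervalIntegrable _ _)
      ((Real.continuous_exp.mul continuous_const).intervalIntegrable _ _) fun r hr ↦ ?_
    exact mul_le_mul_of_nonneg_left (hm (Real.toNNReal_le_iff_le_coe.2 hr.2)) (Real.exp_nonneg r)
  rw [intervalIntegral.integral_mul_const, integral_exp] at h1
  have h2 := expStieltjes_sub hh s t
  nlinarith [hm hst, Real.exp_pos s]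

lemma expStieltjes_eq_of_forall_eq {h : ℝ≥0 → ℝ} (hh : Continuous h) {s t : ℝ≥0} (hst : s ≤ t)
    (hc : ∀ r ∈ Icc s t, h r = h t) : expStieltjes h s = expStieltjes h t := by
  have hst' : (s : ℝ) ≤ t := hst
  have h1 : ∫ r in (s : ℝ)..t, Real.exp r * h r.toNNReal
      = ∫ r in (s : ℝ)..t, Real.exp r * h t := by
    refine intervalIntegral.integral_congr fun r hr ↦ ?_
    rw [uIcc_of_le hst'] at hr
    rw [hc _ ⟨NNReal.le_toNNReal_of_coe_le hr.1, Real.toNNReal_le_iff_le_coe.2 hr.2⟩]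
  have h2 := expStieltjes_sub hh s t
  rw [h1, intervalIntegral.integral_mul_const, integral_exp, hc s ⟨le_rfl, hst⟩] at h2
  linarith

lemma expStieltjes_zero {h : ℝ≥0 → ℝ} : expStieltjes h 0 = h 0 := by
  simp [expStieltjes]

/-- Variation of constants for `x = x₀ - ∫ x + h`. -/
lemma exp_mul_eq_add_expStieltjes {x h : ℝ≥0 → ℝ} {x₀ : ℝ} (hx : Continuous x)
    (hh : Continuous h)
    (heq : ∀ t : ℝ≥0, x t = x₀ - (∫ s in (0 : ℝ)..t, x s.toNNReal) + h t) (t : ℝ≥0) :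
    Real.exp t * x t = x₀ + expStieltjes h t := by
  have hxc := continuous_comp_toNNReal hx
  set I : ℝ → ℝ := fun t ↦ ∫ s in (0 : ℝ)..t, x s.toNNReal with hI
  have hId (s : ℝ) : HasDerivAt I (x s.toNNReal) s :=
    intervalIntegral.integral_hasDerivAt_right (hxc.intervalIntegrable _ _)
      hxc.aestronglyMeasurable.stronglyMeasurableAtFilter hxc.continuousAt
  have hIc : Continuous I := continuous_iff_continuousAt.2 fun s ↦ (hId s).continuousAt
  have h1 := intervalIntegral.integral_eq_sub_of_hasDerivAt (a := 0) (b := t)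
    (fun s _ ↦ (Real.hasDerivAt_exp s).mul (hId s))
    (Continuous.intervalIntegrable (by fun_prop) _ _)
  -- The integrand is the derivative of `eˢ I s`, and the equation replaces `I + x` by `x₀ + h`.
  have h2 : ∫ s in (0 : ℝ)..t, (Real.exp s * I s + Real.exp s * x s.toNNReal)
      = ∫ s in (0 : ℝ)..t, (Real.exp s * x₀ + Real.exp s * h s.toNNReal) := by
    refine intervalIntegral.integral_congr fun r hr ↦ ?_
    rw [uIcc_of_le t.coe_nonneg] at hr
    have := heq r.toNNReal
    rw [Real.coe_toNNReal r hr.1] at this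
    simp only [hI]
    rw [this]
    ring
  rw [h2, intervalIntegral.integral_add (f := fun s ↦ Real.exp s * x₀)
    ((Real.continuous_exp.mul continuous_const).intervalIntegrable _ _)
    ((continuous_exp_mul_comp_toNNReal hh).intervalIntegrable _ _),
    intervalIntegral.integral_mul_const, integral_exp] at h1
  have hI0 : I 0 = 0 := by simp [hI]
  simp only [Pi.mul_apply, hI0, Real.exp_zero, mul_zero, sub_zero] at h1
  have h3 := heq t
  change x t = x₀ - I t + h t at h3
  rw [h3]
  simp only [expStieltjes]
  linarith

/-! ### Running maximum and Skorokhod reflection -/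

/-- The running maximum `max_{s ≤ t} f s` of a continuous function. -/
noncomputable def runningMax (f : ℝ≥0 → ℝ) (t : ℝ≥0) : ℝ :=
  sSup ((fun u : ℝ≥0 ↦ f (t * u)) '' Icc 0 1)

/-- Writing the times up to `t` as `t * u` keeps the compact index set `[0, 1]` fixed as `t` varies.
-/
lemma continuous_runningMax {f : ℝ≥0 → ℝ} (hf : Continuous f) : Continuous (runningMax f) :=
  isCompact_Icc.continuous_sSup (f := fun t u : ℝ≥0 ↦ f (t * u)) (by fun_prop)

lemma runningMax_lt_iff {f : ℝ≥0 → ℝ} (hf : Continuous f) {t : ℝ≥0} {c : ℝ} :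
    runningMax f t < c ↔ ∀ s ≤ t, f s < c := by
  unfold runningMax
  rw [isCompact_Icc.sSup_lt_iff_of_continuous (nonempty_Icc.2 zero_le_one)
    (by fun_prop : ContinuousOn (fun u ↦ f (t * u)) _)]
  refine ⟨fun h s hs ↦ ?_, fun h u hu ↦ h _ (mul_le_of_le_one_right' hu.2)⟩
  rcases eq_or_ne t 0 with rfl | ht
  · simpa [nonpos_iff_eq_zero.1 hs] using h 0 (by simp)
  · have := h (s / t) ⟨zero_le, div_le_one_of_le₀ hs zero_le⟩
    rwa [mul_div_cancel₀ _ ht] at this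

lemma le_runningMax {f : ℝ≥0 → ℝ} (hf : Continuous f) {s t : ℝ≥0} (hst : s ≤ t) :
    f s ≤ runningMax f t :=
  le_of_forall_gt fun _ hc ↦ (runningMax_lt_iff hf).1 hc s hst

lemma runningMax_le {f : ℝ≥0 → ℝ} (hf : Continuous f) {t : ℝ≥0} {c : ℝ}
    (h : ∀ s ≤ t, f s ≤ c) : runningMax f t ≤ c :=
  le_of_forall_gt fun _ hd ↦ (runningMax_lt_iff hf).2 fun s hs ↦ (h s hs).trans_lt hd

/-- The explicit solution of the Skorokhod reflection problem at a moving lower barrier `c`. -/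
lemma skorokhod_regulator_eq {v g K c : ℝ≥0 → ℝ} (hg : Continuous g) (hc : Continuous c)
    (hK : Continuous K) (heq : ∀ t, v t = g t + K t) (hge : ∀ t, c t ≤ v t) (hm : Monotone K)
    (h0 : K 0 = 0) (hflat : ∀ s t, s ≤ t → (∀ r ∈ Icc s t, v r ≠ c r) → K s = K t) (t : ℝ≥0) :
    K t = runningMax (fun s ↦ max 0 (c s - g s)) t := by
  have hv : Continuous v := by
    rw [show v = fun t ↦ g t + K t from funext heq]
    fun_prop
  have hf : Continuous fun s ↦ max 0 (c s - g s) := by fun_prop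
  apply le_antisymm
  -- Take the last contact time `s ≤ t`: there `K s = c s - g s`, and `K` is constant afterwards.
  -- Without contact, `K t = K 0 = 0`.
  · have hcomp : IsCompact (Icc 0 t ∩ {r | v r = c r}) :=
      isCompact_Icc.inter_right (isClosed_eq hv hc)
    rcases (Icc 0 t ∩ {r | v r = c r}).eq_empty_or_nonempty with he | hne
    · rw [← hflat 0 t zero_le fun r hr hvr ↦ (he ▸ (⟨hr, hvr⟩ : r ∈ Icc 0 t ∩ {r | v r = c r}) :
        r ∈ (∅ : Set ℝ≥0)), h0]
      exact (le_max_left _ _).trans (le_runningMax hf (zero_le : 0 ≤ t))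
    · obtain ⟨s, ⟨⟨-, hst⟩, hvs : v s = c s⟩, hmax⟩ := hcomp.exists_isGreatest hne
      have hKs : K s = K t := by
        rcases hst.eq_or_lt with rfl | hlt
        · rfl
        -- Flatness is only available strictly after the contact time; continuity of `K` carries it
        -- to `s`.
        have hsub : Ioc s t ⊆ {r | K r = K t} := fun r hr ↦ hflat r t hr.2 fun q hq hvq ↦
          (hr.1.trans_le hq.1).not_ge (hmax ⟨⟨zero_le, hq.2⟩, hvq⟩)
        have := closure_minimal hsub (isClosed_eq hK continuous_const)
        rw [closure_Ioc hlt.ne] at this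
        exact this ⟨le_rfl, hst⟩
      rw [← hKs, show K s = c s - g s by rw [← hvs, heq s]; ring]
      exact (le_max_right _ _).trans (le_runningMax hf hst)
  · refine runningMax_le hf fun s hs ↦ max_le (h0 ▸ hm zero_le) ?_
    have := hge s
    rw [heq s] at this
    linarith [hm hs]

/-- The solution of the Ornstein-Uhlenbeck equation `x = x₀ - ∫ x + σ w`. -/
noncomputable def ouPath (σ x₀ : ℝ) (w : ℝ≥0 → ℝ) (t : ℝ≥0) : ℝ :=
  Real.exp (-t) * (x₀ + σ * expStieltjes w t)

/-- The solution of the Ornstein-Uhlenbeck equation `x = x₀ - ∫ x + σ w + ℓ` reflected upwards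
at `a`. -/
noncomputable def reflectedOUPath (σ x₀ a : ℝ) (w : ℝ≥0 → ℝ) (t : ℝ≥0) : ℝ :=
  Real.exp (-t) * (x₀ + σ * expStieltjes w t +
    runningMax (fun s ↦ max 0 (a * Real.exp s - (x₀ + σ * expStieltjes w s))) t)

lemma continuous_ouPath {σ x₀ : ℝ} {w : ℝ≥0 → ℝ} (hw : Continuous w) :
    Continuous (ouPath σ x₀ w) := by
  have := continuous_expStieltjes hw
  unfold ouPath
  fun_prop

lemma continuous_reflectedOUPath {σ x₀ a : ℝ} {w : ℝ≥0 → ℝ} (hw : Continuous w) :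
    Continuous (reflectedOUPath σ x₀ a w) := by
  have := continuous_expStieltjes hw
  have h2 : Continuous
      (runningMax fun s ↦ max 0 (a * Real.exp s - (x₀ + σ * expStieltjes w s))) :=
    continuous_runningMax (by fun_prop)
  unfold reflectedOUPath
  fun_prop

lemma eq_ouPath {σ x₀ : ℝ} {w x : ℝ≥0 → ℝ} (hw : Continuous w) (hx : Continuous x)
    (heq : ∀ t : ℝ≥0, x t = x₀ - (∫ s in (0 : ℝ)..t, x s.toNNReal) + σ * w t) (t : ℝ≥0) :
    x t = ouPath σ x₀ w t := by
  have h1 := exp_mul_eq_add_expStieltjes hx (by fun_prop : Continuous fun t ↦ σ * w t + 0)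
    (by simpa using heq) t
  rw [expStieltjes_const_mul_add hw continuous_const] at h1
  rw [ouPath, Real.exp_neg, eq_inv_mul_iff_mul_eq₀ (Real.exp_ne_zero _), h1]
  simp [expStieltjes]

/-- `eᵗ x t` solves a driftless Skorokhod problem with moving barrier `a eᵗ` and regulator `∫ eˢ
dℓ`, so that regulator is a running maximum. -/
lemma eq_reflectedOUPath {σ x₀ a : ℝ} {w x ℓ : ℝ≥0 → ℝ} (hw : Continuous w) (hx : Continuous x)
    (hge : ∀ t, a ≤ x t) (hl : IsRegulator a x ℓ)
    (heq : ∀ t : ℝ≥0, x t = x₀ - (∫ s in (0 : ℝ)..t, x s.toNNReal) + σ * w t + ℓ t) (t : ℝ≥0) :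
    x t = reflectedOUPath σ x₀ a w t := by
  have hlc := hl.continuous
  have h1 (t : ℝ≥0) : Real.exp t * x t = x₀ + σ * expStieltjes w t + expStieltjes ℓ t := by
    rw [exp_mul_eq_add_expStieltjes hx (by fun_prop : Continuous fun t ↦ σ * w t + ℓ t)
      (fun t ↦ by rw [heq t]; ring) t, expStieltjes_const_mul_add hw hlc]
    ring
  have hwc := continuous_expStieltjes hw
  have h2 := skorokhod_regulator_eq (v := fun t ↦ Real.exp t * x t)
    (c := fun t ↦ a * Real.exp t) (by fun_prop) (by fun_prop) (continuous_expStieltjes hlc) h1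
    (fun t ↦ by rw [mul_comm]; exact mul_le_mul_of_nonneg_left (hge t) (Real.exp_nonneg _))
    (expStieltjes_monotone hlc hl.monotone) (expStieltjes_zero.trans hl.zero)
    (fun s t hst hne ↦ expStieltjes_eq_of_forall_eq hlc hst fun r hr ↦ hl.flat r t hr.2
      fun q hq hxq ↦ hne q ⟨hr.1.trans hq.1, hq.2⟩ (by rw [hxq, mul_comm])) t
  rw [reflectedOUPath, Real.exp_neg, eq_inv_mul_iff_mul_eq₀ (Real.exp_ne_zero _), h1, h2]

/-! ### Measurable functionals on path space -/

/-- Continuous real paths, with the σ-algebra generated by the evaluations. -/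
abbrev PathSpace := {w : ℝ≥0 → ℝ // Continuous w}

lemma measurable_pathSpace_eval (t : ℝ≥0) : Measurable fun w : PathSpace ↦ w.1 t :=
  (measurable_pi_apply t).comp measurable_subtype_coe

lemma measurable_expStieltjes (t : ℝ≥0) :
    Measurable fun w : PathSpace ↦ expStieltjes w.1 t := by
  have h1 : Measurable (Function.uncurry fun (s : ℝ) (w : PathSpace) ↦
      Real.exp s * w.1 s.toNNReal) :=
    measurable_uncurry_of_continuous_of_measurable
      (fun w ↦ continuous_exp_mul_comp_toNNReal w.2)
      fun s ↦ (measurable_pathSpace_eval _).const_mul _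
  have h2 : Measurable fun w : PathSpace ↦ ∫ s in (0 : ℝ)..t, Real.exp s * w.1 s.toNNReal := by
    simp_rw [intervalIntegral.integral_of_le t.coe_nonneg]
    exact h1.stronglyMeasurable.integral_prod_left.measurable
  exact ((measurable_pathSpace_eval t).const_mul _).sub h2

section

variable {E : Type*} [MeasurableSpace E]

lemma measurable_runningMax {f : ℝ≥0 → E → ℝ} (hc : ∀ w, Continuous fun t ↦ f t w)
    (hm : ∀ t, Measurable (f t)) (t : ℝ≥0) :
    Measurable fun w ↦ runningMax (fun s ↦ f s w) t := by
  refine measurable_of_Iic fun c ↦ ?_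
  have : (fun w ↦ runningMax (fun s ↦ f s w) t) ⁻¹' Iic c
      -- By continuity a countable dense set of times suffices; the `min` keeps them in `[0, t]`.
      = ⋂ n : ℕ, {w | f (min t (TopologicalSpace.denseSeq ℝ≥0 n)) w ≤ c} := by
    ext w
    simp only [mem_preimage, mem_Iic, mem_iInter, mem_ofPred_eq]
    refine ⟨fun h n ↦ (le_runningMax (hc w) (min_le_left _ _)).trans h, fun h ↦
      runningMax_le (hc w) fun s hs ↦ ?_⟩
    have hcl : IsClosed {s | f (min t s) w ≤ c} :=
      isClosed_le ((hc w).comp (continuous_const.min continuous_id)) continuous_const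
    have := closure_minimal (range_subset_iff.2 h) hcl
    rw [(TopologicalSpace.denseRange_denseSeq ℝ≥0).closure_range] at this
    simpa [min_eq_right hs] using this (mem_univ s)
  rw [this]
  exact .iInter fun n ↦ hm _ measurableSet_Iic

/-- Since `D` is open, a path in `D` at time `t` remains there a little longer, which makes the
inequality strict. -/
lemma lt_exitTime_iff {E : Type*} {X : ℝ≥0 → E → ℝ} {D : Set ℝ} (hD : IsOpen D) {w : E}
    (hc : Continuous fun t ↦ X t w) {t : ℝ≥0} :
    (t : ℝ≥0∞) < exitTime X D w ↔ ∀ s ≤ t, X s w ∈ D := by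
  refine ⟨fun h s hs ↦ ?_, fun h ↦ ?_⟩
  · by_contra hn
    exact ((h.trans_le (iInf₂_le s hn)).trans_le (by exact_mod_cast hs)).false
  · have hnhds : {s | X s w ∈ D} ∈ nhds t := (hD.preimage hc).mem_nhds (h t le_rfl)
    obtain ⟨u, hu, hsub⟩ := exists_Ico_subset_of_mem_nhds hnhds ⟨t + 1, by simp⟩
    refine (by exact_mod_cast hu : (t : ℝ≥0∞) < u).trans_le (le_iInf₂ fun s hs ↦ ?_)
    by_contra! hsu
    have hsu' : s < u := by exact_mod_cast hsu
    rcases le_total s t with hst | hst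
    · exact hs (h s hst)
    · exact hs (hsub ⟨hst, hsu'⟩)

/-- Describing the domain as `0 < d` turns survival up to `r` into negativity of one running
maximum. -/
lemma measurable_exitTime {X : ℝ≥0 → E → ℝ} {d : ℝ → ℝ} (hd : Continuous d)
    (hc : ∀ w, Continuous fun t ↦ X t w) (hm : ∀ t, Measurable (X t)) :
    Measurable (exitTime X {x | 0 < d x}) := by
  refine measurable_of_Ioi fun r ↦ ?_
  induction r with
  | top => simp
  | coe r =>
    have : exitTime X {x | 0 < d x} ⁻¹' Ioi (r : ℝ≥0∞)
        = {w | runningMax (fun s ↦ -d (X s w)) r < 0} := by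
      ext w
      have h1 : Continuous fun s ↦ -d (X s w) := (hd.comp (hc w)).neg
      rw [mem_preimage, mem_Ioi, lt_exitTime_iff (isOpen_lt continuous_const hd) (hc w),
        mem_ofPred_eq, runningMax_lt_iff h1]
      simp
    rw [this]
    exact measurable_runningMax (f := fun s w ↦ -d (X s w)) (fun w ↦ (hd.comp (hc w)).neg)
      (fun t ↦ (hd.measurable.comp (hm t)).neg) r measurableSet_Iio

end

lemma measurable_ouPath (σ x₀ : ℝ) (t : ℝ≥0) :
    Measurable fun w : PathSpace ↦ ouPath σ x₀ w.1 t := by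
  have := measurable_expStieltjes t
  unfold ouPath
  fun_prop

lemma measurable_reflectedOUPath (σ x₀ a : ℝ) (t : ℝ≥0) :
    Measurable fun w : PathSpace ↦ reflectedOUPath σ x₀ a w.1 t := by
  have h1 := measurable_expStieltjes t
  have h2 := measurable_runningMax
    (f := fun s (w : PathSpace) ↦ max 0 (a * Real.exp s - (x₀ + σ * expStieltjes w.1 s)))
    (fun w ↦ by have := continuous_expStieltjes w.2; fun_prop)
    (fun s ↦ by have := measurable_expStieltjes s; fun_prop) t
  unfold reflectedOUPath
  fun_prop

/-! ### The law of Brownian motion on path space -/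

/-- A process with continuous paths, as a random element of path space; discontinuous paths are
replaced by `0`. -/
noncomputable def toPathSpace {Ω : Type*} (B : ℝ≥0 → Ω → ℝ) (ω : Ω) : PathSpace :=
  open Classical in if h : Continuous fun t ↦ B t ω then ⟨_, h⟩ else ⟨0, continuous_const⟩

section

variable {Ω : Type*} [MeasurableSpace Ω] {P : Measure Ω} {B : ℝ≥0 → Ω → ℝ}

lemma toPathSpace_apply {Ω : Type*} {B : ℝ≥0 → Ω → ℝ} {ω : Ω} (h : Continuous fun t ↦ B t ω) (t : ℝ≥0) :
    (toPathSpace B ω).1 t = B t ω := by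
  simp [toPathSpace, h]

/-- Continuity and measurability of coordinates hold only up to null sets. On a measurable set of
full measure, the coordinates at countably many dense times agree with measurable versions; the
other coordinates are limits of these. -/
lemma aemeasurable_toPathSpace (hc : ∀ᵐ ω ∂P, Continuous fun t ↦ B t ω)
    (hm : ∀ t, AEMeasurable (B t) P) : AEMeasurable (toPathSpace B) P := by
  set q := TopologicalSpace.denseSeq ℝ≥0
  have hae : ∀ᵐ ω ∂P, (Continuous fun t ↦ B t ω) ∧ ∀ n, B (q n) ω = (hm (q n)).mk _ ω :=
    hc.and (ae_all_iff.2 fun n ↦ (hm (q n)).ae_eq_mk)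
  obtain ⟨S, hPS, hSm, hS⟩ := hae.exists_measurable_mem
  set C : Ω → PathSpace := open Classical in
    fun ω ↦ if h : ω ∈ S then ⟨_, (hS _ h).1⟩ else ⟨0, continuous_const⟩ with hC
  have hCn (n : ℕ) : Measurable fun ω ↦ (C ω).1 (q n) := by
    have : (fun ω ↦ (C ω).1 (q n)) = S.indicator ((hm (q n)).mk _) := by
      ext ω
      by_cases h : ω ∈ S
      · simp [hC, h, (hS _ h).2 n]
      · simp [hC, h]
    rw [this]
    exact (hm (q n)).measurable_mk.indicator hSm
  have hCm : Measurable C := by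
    refine Measurable.subtype_mk (p := Continuous) (f := fun ω ↦ (C ω).1) (hf := ?_) (h := ?_)
    refine measurable_pi_iff.2 fun t ↦ ?_
    obtain ⟨u, hu, hut⟩ := mem_closure_iff_seq_limit.1
      (TopologicalSpace.denseRange_denseSeq ℝ≥0 t)
    choose k hk using hu
    refine measurable_of_tendsto_metrizable (f := fun n ω ↦ (C ω).1 (u n))
      (fun n ↦ hk n ▸ hCn (k n)) (tendsto_pi_nhds.2 fun ω ↦ ((C ω).2.tendsto t).comp hut)
  refine ⟨C, hCm, ?_⟩
  filter_upwards [hPS] with ω hω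
  simp [hC, hω, toPathSpace, (hS _ hω).1]

lemma map_val_map_toPathSpace (hB : IsBrownianReal B P) :
    IsProjectiveLimit ((P.map (toPathSpace B)).map Subtype.val)
      BrownianReal.projectiveFamily := by
  intro I
  have hm := aemeasurable_toPathSpace hB.cont hB.aemeasurable
  rw [Measure.map_map (by fun_prop) measurable_subtype_coe,
    AEMeasurable.map_map_of_aemeasurable (by fun_prop) hm, ← (hB.hasLaw I).map_eq]
  refine Measure.map_congr ?_
  filter_upwards [hB.cont] with ω hω
  ext t
  simp [toPathSpace_apply hω]

/-- Any two Brownian motions have the same law on path space. -/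
lemma map_toPathSpace_eq {Ω' : Type*} [MeasurableSpace Ω'] {P' : Measure Ω'} {B' : ℝ≥0 → Ω' → ℝ}
    (hB : IsBrownianReal B P) (hB' : IsBrownianReal B' P') :
    P.map (toPathSpace B) = P'.map (toPathSpace B') := by
  have h := (map_val_map_toPathSpace hB).unique (map_val_map_toPathSpace hB')
  ext S hS
  -- The σ-algebra on paths is induced from the product, where the projective limit is unique.
  obtain ⟨T, hT, rfl⟩ := hS
  rw [← Measure.map_apply measurable_subtype_coe hT, h,
    Measure.map_apply measurable_subtype_coe hT]

end

/-! ### Rescaling time and reflecting space -/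

section

variable {Ω : Type*} [MeasurableSpace Ω] {P : Measure Ω}

lemma exitTime_comp_inv_mul {Ω : Type*} {c : ℝ≥0} (hc : c ≠ 0) (X : ℝ≥0 → Ω → ℝ) (D : Set ℝ)
    (ω : Ω) : exitTime (fun t ↦ X (c⁻¹ * t)) D ω = c * exitTime X D ω := by
  have hc' : (c : ℝ≥0∞) ≠ 0 := by exact_mod_cast hc
  simp only [exitTime]
  rw [ENNReal.mul_iInf_of_ne hc' ENNReal.coe_ne_top]
  simp_rw [ENNReal.mul_iInf_of_ne hc' ENNReal.coe_ne_top]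
  refine (Equiv.mulLeft₀ c⁻¹ (inv_ne_zero hc)).iInf_congr fun t ↦ iInf_congr fun h ↦ ?_
  simp only [Equiv.mulLeft₀_apply]
  rw [← ENNReal.coe_mul, mul_inv_cancel_left₀ hc]

lemma integral_comp_inv_mul_toNNReal {c : ℝ≥0} (hc : c ≠ 0) (x : ℝ≥0 → ℝ) (t : ℝ≥0) :
    ∫ s in (0 : ℝ)..t, x (c⁻¹ * s.toNNReal)
      = c * ∫ s in (0 : ℝ)..(c⁻¹ * t : ℝ≥0), x s.toNNReal := by
  have h := intervalIntegral.integral_comp_mul_left (fun s : ℝ ↦ x s.toNNReal) (a := 0) (b := t)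
    (inv_ne_zero (NNReal.coe_ne_zero.2 hc))
  simp only [mul_zero, inv_inv, smul_eq_mul] at h
  rw [NNReal.coe_mul, NNReal.coe_inv, ← h]
  congr! 3 with s
  rw [Real.toNNReal_mul (by positivity), ← NNReal.coe_inv, Real.toNNReal_coe]

/-- The factor `√c` is absorbed by Brownian scaling, as `√c = (√c⁻¹)⁻¹`. -/
lemma rescaled_equation {c : ℝ≥0} (hc : c ≠ 0) {σ x₀ : ℝ} {w x ℓ : ℝ≥0 → ℝ}
    (h : ∀ t : ℝ≥0, x t = x₀ - c * (∫ s in (0 : ℝ)..t, x s.toNNReal) + σ * √c * w t + ℓ t)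
    (t : ℝ≥0) :
    x (c⁻¹ * t) = x₀ - 1 * (∫ s in (0 : ℝ)..t, x (c⁻¹ * s.toNNReal))
      + σ * √1 * ((√(c⁻¹ : ℝ≥0))⁻¹ * w (c⁻¹ * t)) + ℓ (c⁻¹ * t) := by
  rw [h, integral_comp_inv_mul_toNNReal hc]
  simp
  ring

lemma IsRegulator.comp_mul {c : ℝ} {x ℓ : ℝ≥0 → ℝ} (h : IsRegulator c x ℓ) {r : ℝ≥0}
    (hr : r ≠ 0) : IsRegulator c (fun t ↦ x (r * t)) (fun t ↦ ℓ (r * t)) where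
  continuous := h.continuous.comp (by fun_prop)
  monotone s t hst := h.monotone (by gcongr)
  zero := by simp [h.zero]
  flat s t hst hne := h.flat _ _ (by gcongr) fun q hq ↦ by
    have := hne (r⁻¹ * q) ⟨(le_inv_mul_iff₀ (pos_iff_ne_zero.2 hr)).2 hq.1,
      (inv_mul_le_iff₀ (pos_iff_ne_zero.2 hr)).2 hq.2⟩
    rwa [mul_inv_cancel_left₀ hr] at this

lemma IsRegulator.neg {c : ℝ} {x ℓ : ℝ≥0 → ℝ} (h : IsRegulator c x ℓ) :
    IsRegulator (-c) (fun t ↦ -x t) ℓ where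
  continuous := h.continuous
  monotone := h.monotone
  zero := h.zero
  flat s t hst hne := h.flat s t hst fun r hr hx ↦ hne r hr (by rw [hx])

lemma IsOUProcess.rescale {c : ℝ≥0} (hc : c ≠ 0) {σ x₀ : ℝ} {W X : ℝ≥0 → Ω → ℝ}
    (h : IsOUProcess P c σ x₀ W X) :
    IsOUProcess P 1 σ x₀ (fun t ω ↦ (√(c⁻¹ : ℝ≥0))⁻¹ * W (c⁻¹ * t) ω)
      (fun t ↦ X (c⁻¹ * t)) where
  brownian := h.brownian.smul (inv_ne_zero hc)
  continuous_paths := h.continuous_paths.mono fun ω hω ↦ hω.comp (by fun_prop)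
  equation := h.equation.mono fun ω hω t ↦ by
    simpa using rescaled_equation hc (ℓ := 0) (by simpa using hω) t

lemma IsLowerReflectedOUProcess.rescale {c : ℝ≥0} (hc : c ≠ 0) {σ x₀ a : ℝ}
    {W X L : ℝ≥0 → Ω → ℝ} (h : IsLowerReflectedOUProcess P c σ x₀ a W X L) :
    IsLowerReflectedOUProcess P 1 σ x₀ a (fun t ω ↦ (√(c⁻¹ : ℝ≥0))⁻¹ * W (c⁻¹ * t) ω)
      (fun t ↦ X (c⁻¹ * t)) (fun t ↦ L (c⁻¹ * t)) where
  brownian := h.brownian.smul (inv_ne_zero hc)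
  continuous_paths := h.continuous_paths.mono fun ω hω ↦ hω.comp (by fun_prop)
  mem := h.mem.mono fun ω hω t ↦ hω _
  regulator := h.regulator.mono fun ω hω ↦ hω.comp_mul (inv_ne_zero hc)
  equation := h.equation.mono fun ω hω t ↦ rescaled_equation hc hω t

lemma IsUpperReflectedOUProcess.neg {θ σ x₀ b : ℝ}
    {W X L : ℝ≥0 → Ω → ℝ} (h : IsUpperReflectedOUProcess P θ σ x₀ b W X L) :
    IsLowerReflectedOUProcess P θ σ (-x₀) (-b) (-W) (fun t ω ↦ -X t ω) L where
  brownian := h.brownian.neg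
  continuous_paths := h.continuous_paths.mono fun ω hω ↦ hω.neg
  mem := h.mem.mono fun ω hω t ↦ neg_le_neg (hω t)
  regulator := h.regulator.mono fun ω hω ↦ hω.neg
  equation := h.equation.mono fun ω hω t ↦ by
    rw [intervalIntegral.integral_neg, hω t]
    simp only [Pi.neg_apply]
    ring

lemma isOUFirstPassageTime_lower_of_upper {θ σ a b x₀ : ℝ} {τ : Ω → ℝ≥0∞}
    (h : IsOUFirstPassageTime P .upperReflecting θ σ a b x₀ τ) :
    IsOUFirstPassageTime P .lowerReflecting θ σ (-b) (-a) (-x₀) τ := by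
  obtain ⟨W, X, L, hX, rfl⟩ := h
  refine ⟨_, _, _, hX.neg, ?_⟩
  ext ω
  simp [exitTime]

lemma IsOUFirstPassageTime.rescale_of_ne_upper {k : Thresholds} (hk : k ≠ .upperReflecting) {θ : ℝ}
    (hθ : 0 < θ) {σ a b x₀ : ℝ} {τ : Ω → ℝ≥0∞} (h : IsOUFirstPassageTime P k θ σ a b x₀ τ) :
    IsOUFirstPassageTime P k 1 σ a b x₀ (fun ω ↦ ENNReal.ofReal θ * τ ω) := by
  lift θ to ℝ≥0 using hθ.le
  have hc : θ ≠ 0 := by exact_mod_cast hθ.ne'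
  simp only [ENNReal.ofReal_coe_nnreal]
  match k with
  | .bothAbsorbing =>
    obtain ⟨W, X, hX, rfl⟩ := h
    exact ⟨_, _, hX.rescale hc, funext fun ω ↦ (exitTime_comp_inv_mul hc _ _ _).symm⟩
  | .lowerReflecting =>
    obtain ⟨W, X, L, hX, rfl⟩ := h
    exact ⟨_, _, _, hX.rescale hc, funext fun ω ↦ (exitTime_comp_inv_mul hc _ _ _).symm⟩
  | .upperReflecting => exact absurd rfl hk

end

/-! ### The first passage time as a functional of the Brownian path -/

/-- The first passage time of the process with unit drift coefficient, as a functional of the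
driving path. The upper reflecting case is obtained from the lower reflecting one by symmetry. -/
noncomputable def passageFunctional (k : Thresholds) (σ a b x₀ : ℝ) : PathSpace → ℝ≥0∞ :=
  match k with
  | .bothAbsorbing => exitTime (fun t w ↦ ouPath σ x₀ w.1 t) (Ioo a b)
  | .lowerReflecting => exitTime (fun t w ↦ reflectedOUPath σ x₀ a w.1 t) (Iio b)
  | .upperReflecting => exitTime (fun t w ↦ reflectedOUPath σ (-x₀) (-b) w.1 t) (Iio (-a))

lemma measurable_exitTime_Iio {E : Type*} [MeasurableSpace E] {X : ℝ≥0 → E → ℝ} (b : ℝ)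
    (hc : ∀ w, Continuous fun t ↦ X t w) (hm : ∀ t, Measurable (X t)) :
    Measurable (exitTime X (Iio b)) := by
  rw [show Iio b = {x | 0 < b - x} by ext x; simp]
  exact measurable_exitTime (by fun_prop) hc hm

lemma measurable_passageFunctional (k : Thresholds) (σ a b x₀ : ℝ) :
    Measurable (passageFunctional k σ a b x₀) := by
  match k with
  | .bothAbsorbing =>
    unfold passageFunctional
    rw [show Ioo a b = {x | 0 < min (x - a) (b - x)} by ext x; simp]
    exact measurable_exitTime (by fun_prop) (fun w ↦ continuous_ouPath w.2)
      (measurable_ouPath σ x₀)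
  | .lowerReflecting =>
    exact measurable_exitTime_Iio _ (fun w ↦ continuous_reflectedOUPath w.2)
      (measurable_reflectedOUPath σ x₀ a)
  | .upperReflecting =>
    exact measurable_exitTime_Iio _ (fun w ↦ continuous_reflectedOUPath w.2)
      (measurable_reflectedOUPath σ (-x₀) (-b))

section

variable {Ω : Type*} [MeasurableSpace Ω] {P : Measure Ω}

lemma exitTime_congr {Ω Ω' : Type*} {X : ℝ≥0 → Ω → ℝ} {Y : ℝ≥0 → Ω' → ℝ} {D : Set ℝ} {ω : Ω}
    {ω' : Ω'} (h : ∀ t, X t ω = Y t ω') : exitTime X D ω = exitTime Y D ω' := by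
  simp [exitTime, h]

lemma IsLowerReflectedOUProcess.exitTime_ae_eq {σ x₀ a b : ℝ} {W X L : ℝ≥0 → Ω → ℝ}
    (h : IsLowerReflectedOUProcess P 1 σ x₀ a W X L) :
    exitTime X (Iio b) =ᵐ[P] fun ω ↦
      exitTime (fun t (w : PathSpace) ↦ reflectedOUPath σ x₀ a w.1 t) (Iio b)
        (toPathSpace W ω) := by
  filter_upwards [h.brownian.cont, h.continuous_paths, h.mem, h.regulator, h.equation]
    with ω hw hx hge hl heq
  refine exitTime_congr fun t ↦ ?_
  have hW : (toPathSpace W ω).1 = fun t ↦ W t ω := funext (toPathSpace_apply hw)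
  rw [hW]
  exact eq_reflectedOUPath hw hx hge hl (by simpa using heq) t

lemma IsOUProcess.exitTime_ae_eq {σ x₀ : ℝ} {W X : ℝ≥0 → Ω → ℝ} {D : Set ℝ}
    (h : IsOUProcess P 1 σ x₀ W X) :
    exitTime X D =ᵐ[P] fun ω ↦
      exitTime (fun t (w : PathSpace) ↦ ouPath σ x₀ w.1 t) D (toPathSpace W ω) := by
  filter_upwards [h.brownian.cont, h.continuous_paths, h.equation] with ω hw hx heq
  refine exitTime_congr fun t ↦ ?_
  have hW : (toPathSpace W ω).1 = fun t ↦ W t ω := funext (toPathSpace_apply hw)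
  rw [hW]
  exact eq_ouPath hw hx (by simpa using heq) t

lemma IsOUFirstPassageTime.exists_ae_eq_passageFunctional {k : Thresholds} {θ : ℝ} (hθ : 0 < θ)
    {σ a b x₀ : ℝ} {τ : Ω → ℝ≥0∞} (h : IsOUFirstPassageTime P k θ σ a b x₀ τ) :
    ∃ B : ℝ≥0 → Ω → ℝ, IsBrownianReal B P ∧
      (fun ω ↦ ENNReal.ofReal θ * τ ω) =ᵐ[P]
        fun ω ↦ passageFunctional k σ a b x₀ (toPathSpace B ω) := by
  match k with
  | .bothAbsorbing =>
    obtain ⟨W, X, hX, hτ⟩ := h.rescale_of_ne_upper (by simp) hθ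
    exact ⟨W, hX.brownian, hτ ▸ hX.exitTime_ae_eq⟩
  | .lowerReflecting =>
    obtain ⟨W, X, L, hX, hτ⟩ := h.rescale_of_ne_upper (by simp) hθ
    exact ⟨W, hX.brownian, hτ ▸ hX.exitTime_ae_eq⟩
  | .upperReflecting =>
    obtain ⟨W, X, L, hX, hτ⟩ :=
      (isOUFirstPassageTime_lower_of_upper h).rescale_of_ne_upper (by simp) hθ
    exact ⟨W, hX.brownian, hτ ▸ hX.exitTime_ae_eq⟩

lemma IsOUFirstPassageTime.aemeasurable {k : Thresholds} {θ : ℝ} (hθ : 0 < θ)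
    {σ a b x₀ : ℝ} {τ : Ω → ℝ≥0∞} (h : IsOUFirstPassageTime P k θ σ a b x₀ τ) :
    AEMeasurable (fun ω ↦ ENNReal.ofReal θ * τ ω) P := by
  obtain ⟨B, hB, hτ⟩ := h.exists_ae_eq_passageFunctional hθ
  exact ((measurable_passageFunctional k σ a b x₀).comp_aemeasurable
    (aemeasurable_toPathSpace hB.cont hB.aemeasurable)).congr hτ.symm

/-- The law of the rescaled first passage time does not depend on `θ`. -/
lemma IsOUFirstPassageTime.map_eq_map {Ω' : Type*} [MeasurableSpace Ω'] {P' : Measure Ω'}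
    {k : Thresholds} {θ θ' : ℝ} (hθ : 0 < θ) (hθ' : 0 < θ') {σ a b x₀ : ℝ} {τ : Ω → ℝ≥0∞}
    {τ' : Ω' → ℝ≥0∞} (h : IsOUFirstPassageTime P k θ σ a b x₀ τ)
    (h' : IsOUFirstPassageTime P' k θ' σ a b x₀ τ') :
    P.map (fun ω ↦ ENNReal.ofReal θ * τ ω) = P'.map (fun ω ↦ ENNReal.ofReal θ' * τ' ω) := by
  obtain ⟨B, hB, hτ⟩ := h.exists_ae_eq_passageFunctional hθ
  obtain ⟨B', hB', hτ'⟩ := h'.exists_ae_eq_passageFunctional hθ'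
  have hm := measurable_passageFunctional k σ a b x₀
  rw [Measure.map_congr hτ, Measure.map_congr hτ', ← Function.comp_def, ← Function.comp_def,
    ← AEMeasurable.map_map_of_aemeasurable hm.aemeasurable
      (aemeasurable_toPathSpace hB.cont hB.aemeasurable),
    ← AEMeasurable.map_map_of_aemeasurable hm.aemeasurable
      (aemeasurable_toPathSpace hB'.cont hB'.aemeasurable), map_toPathSpace_eq hB hB']

end

/-! ### Tails of the first passage time -/

/-- As long as the path has stayed in `[a, b]`, the increments of the noise are bounded above. -/
lemma noise_increment_le {σ x₀ a b : ℝ} {w x ℓ : ℝ≥0 → ℝ} (hx : Continuous x) (hl : Monotone ℓ)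
    (heq : ∀ t : ℝ≥0, x t = x₀ - (∫ s in (0 : ℝ)..t, x s.toNNReal) + σ * w t + ℓ t)
    {s t : ℝ≥0} (hst : s ≤ t) (hmem : ∀ r ≤ t, x r ∈ Icc a b) :
    σ * (w t - w s) ≤ (b - a) + (t - s) * b := by
  have hst' : (s : ℝ) ≤ t := hst
  have hi (u v : ℝ) := (continuous_comp_toNNReal hx).intervalIntegrable (μ := volume) u v
  have h1 : ∫ r in (s : ℝ)..t, x r.toNNReal ≤ ∫ _ in (s : ℝ)..t, b :=
    intervalIntegral.integral_mono_on hst' (hi _ _) (by simp) fun r hr ↦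
      (hmem _ (Real.toNNReal_le_iff_le_coe.2 hr.2)).2
  rw [intervalIntegral.integral_const, smul_eq_mul,
    ← intervalIntegral.integral_interval_sub_left (hi 0 t) (hi 0 s)] at h1
  have h2 := heq s
  have h3 := heq t
  have h4 := hl hst
  have h5 := (hmem s hst).1
  have h6 := (hmem t le_rfl).2
  -- The noise increment is `x t - x s + ∫ x - (ℓ t - ℓ s)`; a regulator pushing upwards can only
  -- lower it.
  linarith

/-- `τ` is a positive time, and before `τ` the upward increments of `σ B` are bounded. -/
structure BoundsIncrements {Ω : Type*} [MeasurableSpace Ω] (P : Measure Ω) (σ C c : ℝ)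
    (B : ℝ≥0 → Ω → ℝ) (τ : Ω → ℝ≥0∞) : Prop where
  brownian : IsBrownianReal B P
  aemeasurable : AEMeasurable τ P
  pos : ∀ᵐ ω ∂P, 0 < τ ω
  increment_le : ∀ᵐ ω ∂P, ∀ s t : ℝ≥0, s ≤ t → t < τ ω → σ * (B t ω - B s ω) ≤ C + (t - s) * c

section

variable {Ω : Type*} [MeasurableSpace Ω] {P : Measure Ω}

lemma IsOUProcess.boundsIncrements {σ a b x₀ : ℝ} (hx₀ : x₀ ∈ Ioo a b)
    {W X : ℝ≥0 → Ω → ℝ} (h : IsOUProcess P 1 σ x₀ W X)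
    (hm : AEMeasurable (exitTime X (Ioo a b)) P) :
    BoundsIncrements P σ (b - a) b W (exitTime X (Ioo a b)) where
  brownian := h.brownian
  aemeasurable := hm
  pos := by
    filter_upwards [h.brownian.eval_zero_ae_eq_zero, h.continuous_paths, h.equation]
      with ω h0 hx heq
    refine (lt_exitTime_iff isOpen_Ioo hx (t := 0)).2 fun s hs ↦ ?_
    have := heq 0
    simp only [NNReal.coe_zero, intervalIntegral.integral_same, h0] at this
    simpa [nonpos_iff_eq_zero.1 hs, this] using hx₀
  increment_le := by
    filter_upwards [h.continuous_paths, h.equation] with ω hx heq s t hst ht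
    exact noise_increment_le (w := fun t ↦ W t ω) hx (monotone_const (c := 0))
      (by simpa using heq) hst
      fun r hr ↦ Ioo_subset_Icc_self ((lt_exitTime_iff isOpen_Ioo hx).1 ht r hr)

lemma IsLowerReflectedOUProcess.boundsIncrements {σ a b x₀ : ℝ} (hx₀ : x₀ < b)
    {W X L : ℝ≥0 → Ω → ℝ} (h : IsLowerReflectedOUProcess P 1 σ x₀ a W X L)
    (hm : AEMeasurable (exitTime X (Iio b)) P) :
    BoundsIncrements P σ (b - a) b W (exitTime X (Iio b)) where
  brownian := h.brownian
  aemeasurable := hm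
  pos := by
    filter_upwards [h.brownian.eval_zero_ae_eq_zero, h.continuous_paths, h.equation, h.regulator]
      with ω h0 hx heq hl
    refine (lt_exitTime_iff isOpen_Iio hx (t := 0)).2 fun s hs ↦ ?_
    have := heq 0
    simp only [NNReal.coe_zero, intervalIntegral.integral_same, h0, hl.zero] at this
    simpa [nonpos_iff_eq_zero.1 hs, this] using hx₀
  increment_le := by
    filter_upwards [h.continuous_paths, h.equation, h.regulator, h.mem]
      with ω hx heq hl hge s t hst ht
    exact noise_increment_le (w := fun t ↦ W t ω) hx hl.monotone (by simpa using heq) hst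
      fun r hr ↦ ⟨hge r, ((lt_exitTime_iff isOpen_Iio hx).1 ht r hr).le⟩

lemma IsOUFirstPassageTime.exists_boundsIncrements {k : Thresholds} {θ : ℝ} (hθ : 0 < θ)
    {σ a b x₀ : ℝ} (hx₀ : x₀ ∈ Ioo a b) {τ : Ω → ℝ≥0∞}
    (h : IsOUFirstPassageTime P k θ σ a b x₀ τ) :
    ∃ C c B, BoundsIncrements P σ C c B (fun ω ↦ ENNReal.ofReal θ * τ ω) := by
  have hm := h.aemeasurable hθ
  match k with
  | .bothAbsorbing =>
    obtain ⟨W, X, hX, hτ⟩ := h.rescale_of_ne_upper (by simp) hθ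
    rw [hτ] at hm ⊢
    exact ⟨_, _, _, hX.boundsIncrements hx₀ hm⟩
  | .lowerReflecting =>
    obtain ⟨W, X, L, hX, hτ⟩ := h.rescale_of_ne_upper (by simp) hθ
    rw [hτ] at hm ⊢
    exact ⟨_, _, _, hX.boundsIncrements hx₀.2 hm⟩
  | .upperReflecting =>
    obtain ⟨W, X, L, hX, hτ⟩ :=
      (isOUFirstPassageTime_lower_of_upper h).rescale_of_ne_upper (by simp) hθ
    rw [hτ] at hm ⊢
    exact ⟨_, _, _, hX.boundsIncrements (neg_lt_neg hx₀.1) hm⟩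

lemma gaussianReal_Ioi_pos (μ : ℝ) {v : ℝ≥0} (hv : v ≠ 0) (x : ℝ) :
    0 < gaussianReal μ v (Ioi x) := by
  refine pos_iff_ne_zero.2 fun h ↦ ?_
  simpa using gaussianReal_absolutelyContinuous' μ hv h

lemma gaussianReal_Iic_lt_one (μ : ℝ) {v : ℝ≥0} (hv : v ≠ 0) (x : ℝ) :
    gaussianReal μ v (Iic x) < 1 := by
  rw [← compl_Ioi, prob_compl_eq_one_sub measurableSet_Ioi]
  exact ENNReal.sub_lt_self ENNReal.one_ne_top one_ne_zero (gaussianReal_Ioi_pos μ hv x).ne'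

variable {σ C c : ℝ} {B : ℝ≥0 → Ω → ℝ} {τ : Ω → ℝ≥0∞}

/-- A Gaussian increment over `[0, t]` beats the bound with positive probability, and this forces
passage by time `t`. -/
lemma BoundsIncrements.measure_le_pos (h : BoundsIncrements P σ C c B τ) (hσ : 0 < σ) {t : ℝ≥0}
    (ht : 0 < t) : 0 < P {ω | τ ω ≤ t} := by
  have hlaw := h.brownian.hasLaw_sub t 0
  have hv : nndist (t : ℝ) ((0 : ℝ≥0) : ℝ) ≠ 0 := by
    simpa using ht.ne'
  have h1 := hlaw.measure_eq (p := fun x ↦ (C + t * c) / σ < x) measurableSet_Ioi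
  refine ((gaussianReal_Ioi_pos 0 hv ((C + t * c) / σ)).trans_eq h1.symm).trans_le
    (measure_mono_ae ?_)
  filter_upwards [h.increment_le] with ω hω (hlt : _ < B t ω - B 0 ω)
  change τ ω ≤ t
  by_contra! hn
  have := hω 0 t zero_le hn
  rw [div_lt_iff₀ hσ] at hlt
  simp only [NNReal.coe_zero, sub_zero] at this
  linarith

/-- Survival past `n` forces `n` independent standard Gaussian increments below the same level `M`.
-/
lemma BoundsIncrements.exists_measure_lt_le (h : BoundsIncrements P σ C c B τ) (hσ : 0 < σ) :
    ∃ r : ℝ≥0, 0 < r ∧ r < 1 ∧ ∀ n : ℕ, P {ω | n < τ ω} ≤ r ^ n := by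
  set M := (C + c) / σ
  have hG := gaussianReal_Iic_lt_one 0 one_ne_zero M
  -- The maximum with `1/2` makes the ratio visibly positive; the moment bound divides by it.
  refine ⟨max (gaussianReal 0 1 (Iic M)).toNNReal 2⁻¹, by positivity,
    max_lt (ENNReal.toNNReal_lt_of_lt_coe hG) (by norm_num), fun n ↦ ?_⟩
  have hind := h.brownian.hasIndepIncrements.nat (t := fun n : ℕ ↦ (n : ℝ≥0)) Nat.mono_cast
  have hprod := hind.measure_inter_preimage_eq_mul (Finset.range n) (sets := fun _ ↦ Iic M)
    (fun _ _ ↦ measurableSet_Iic)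
  have hterm (i : ℕ) :
      P ((fun ω ↦ B ((i + 1 : ℕ) : ℝ≥0) ω - B (i : ℝ≥0) ω) ⁻¹' Iic M)
        = gaussianReal 0 1 (Iic M) := by
    have hlaw : HasLaw _ (gaussianReal 0 (nndist (((i + 1 : ℕ) : ℝ≥0) : ℝ) ((i : ℝ≥0) : ℝ))) P :=
      h.brownian.hasLaw_sub ((i + 1 : ℕ) : ℝ≥0) (i : ℝ≥0)
    have hv : nndist (((i + 1 : ℕ) : ℝ≥0) : ℝ) ((i : ℝ≥0) : ℝ) = 1 := by
      ext
      simp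
    rw [hv] at hlaw
    exact hlaw.measure_eq (p := fun x ↦ x ≤ M) measurableSet_Iic
  calc P {ω | n < τ ω}
      ≤ P (⋂ i ∈ Finset.range n,
          (fun ω ↦ B ((i + 1 : ℕ) : ℝ≥0) ω - B (i : ℝ≥0) ω) ⁻¹' Iic M) := by
        refine measure_mono_ae ?_
        filter_upwards [h.increment_le] with ω hω (hlt : _ < τ ω)
        refine mem_iInter₂.2 fun i hi ↦ ?_
        have hin : ((i + 1 : ℕ) : ℝ≥0) ≤ n := by exact_mod_cast Finset.mem_range.1 hi
        have := hω i (i + 1 : ℕ) (by simp)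
          ((by exact_mod_cast hin : (((i + 1 : ℕ) : ℝ≥0) : ℝ≥0∞) ≤ n).trans_lt hlt)
        rw [mem_preimage, mem_Iic, le_div_iff₀ hσ]
        push_cast at this ⊢
        linarith
    _ = (gaussianReal 0 1 (Iic M)) ^ n := by rw [hprod]; simp only [hterm]; simp
    _ ≤ _ := by
        gcongr
        rw [← ENNReal.coe_toNNReal hG.ne_top]
        exact_mod_cast le_max_left _ _

lemma BoundsIncrements.ae_lt_top [IsProbabilityMeasure P] (h : BoundsIncrements P σ C c B τ)
    (hσ : 0 < σ) : ∀ᵐ ω ∂P, τ ω < ∞ := by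
  obtain ⟨r, -, hr1, hr⟩ := h.exists_measure_lt_le hσ
  have hle (n : ℕ) : P {ω | ¬ τ ω < ∞} ≤ (r : ℝ≥0∞) ^ n := by
    refine (measure_mono fun ω (hω : ¬ τ ω < ∞) ↦ ?_).trans (hr n)
    rw [not_lt, top_le_iff] at hω
    simp [hω]
  exact nonpos_iff_eq_zero.1 (ge_of_tendsto'
    (ENNReal.tendsto_pow_atTop_nhds_zero_of_lt_one (by exact_mod_cast hr1)) hle)

lemma pow_le_one_add_tsum_indicator {x : ℝ≥0∞} (hx : x < ∞) (m : ℕ) :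
    x ^ m ≤ 1 + ∑' n : ℕ, if n < x then ((n : ℝ≥0∞) + 1) ^ m else 0 := by
  rcases le_or_gt x 1 with h1 | h1
  · exact (pow_le_one' h1 m).trans le_self_add
  lift x to ℝ≥0 using hx.ne
  have hpos : 0 < ⌈x⌉₊ := Nat.ceil_pos.2 (zero_lt_one.trans (by exact_mod_cast h1))
  have hlt : ((⌈x⌉₊ - 1 : ℕ) : ℝ≥0) < x := Nat.lt_ceil.1 (Nat.sub_lt hpos one_pos)
  have hle : (x : ℝ≥0∞) ≤ (⌈x⌉₊ - 1 : ℕ) + 1 := by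
    have : x ≤ ((⌈x⌉₊ - 1 + 1 : ℕ) : ℝ≥0) := by
      rw [Nat.sub_add_cancel hpos]
      exact Nat.le_ceil x
    exact_mod_cast this
  -- The single term `n = ⌈x⌉ - 1`, with `n < x ≤ n + 1`, already dominates.
  refine le_trans ?_ (le_add_self.trans (add_le_add_right (ENNReal.le_tsum (⌈x⌉₊ - 1)) 1))
  rw [if_pos (by exact_mod_cast hlt)]
  gcongr

lemma BoundsIncrements.lintegral_pow_lt_top [IsProbabilityMeasure P]
    (h : BoundsIncrements P σ C c B τ) (hσ : 0 < σ) (m : ℕ) : ∫⁻ ω, τ ω ^ m ∂P < ∞ := by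
  obtain ⟨r, hr0, hr1, hr⟩ := h.exists_measure_lt_le hσ
  have hset (n : ℕ) : NullMeasurableSet {ω | (n : ℝ≥0∞) < τ ω} P :=
    nullMeasurableSet_lt aemeasurable_const h.aemeasurable
  have hsum : Summable fun n : ℕ ↦ ((n : ℝ≥0) + 1) ^ m * r ^ n := by
    rw [← NNReal.summable_coe]
    have h1 := summable_pow_mul_geometric_of_norm_lt_one m (r := (r : ℝ)) (by simpa using hr1)
    have h2 := ((summable_nat_add_iff 1).2 h1).mul_right (r : ℝ)⁻¹
    refine h2.congr fun n ↦ ?_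
    have : (r : ℝ) ≠ 0 := by exact_mod_cast hr0.ne'
    push_cast
    field_simp
    ring
  calc ∫⁻ ω, τ ω ^ m ∂P
      ≤ ∫⁻ ω, 1 + ∑' n : ℕ, {ω | (n : ℝ≥0∞) < τ ω}.indicator
          (fun _ ↦ ((n : ℝ≥0∞) + 1) ^ m) ω ∂P := by
        refine lintegral_mono_ae ?_
        filter_upwards [h.ae_lt_top hσ] with ω hω
        simpa [indicator_apply] using pow_le_one_add_tsum_indicator hω m
    _ = 1 + ∑' n : ℕ, ((n : ℝ≥0∞) + 1) ^ m * P {ω | (n : ℝ≥0∞) < τ ω} := by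
        rw [lintegral_add_left measurable_const, lintegral_tsum fun n ↦
          aemeasurable_const.indicator₀ (hset n)]
        simp_rw [lintegral_indicator_const₀ (hset _)]
        simp
    _ ≤ 1 + ∑' n : ℕ, (((((n : ℝ≥0) + 1) ^ m * r ^ n : ℝ≥0)) : ℝ≥0∞) := by
        gcongr with n
        push_cast
        gcongr
        exact hr n
    _ < ∞ := ENNReal.add_lt_top.2
        ⟨ENNReal.one_lt_top, (ENNReal.tsum_coe_ne_top_iff_summable.2 hsum).lt_top⟩

lemma BoundsIncrements.memLp_toReal [IsProbabilityMeasure P]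
    (h : BoundsIncrements P σ C c B τ) (hσ : 0 < σ) : MemLp (fun ω ↦ (τ ω).toReal) 2 P := by
  refine ⟨h.aemeasurable.ennreal_toReal.aestronglyMeasurable, ?_⟩
  rw [eLpNorm_lt_top_iff_lintegral_rpow_enorm_lt_top two_ne_zero ENNReal.ofNat_ne_top]
  refine (lintegral_mono_ae ?_).trans_lt (h.lintegral_pow_lt_top hσ 2)
  filter_upwards [h.ae_lt_top hσ] with ω hω
  rw [Real.enorm_of_nonneg ENNReal.toReal_nonneg, ENNReal.ofReal_toReal hω.ne]
  simp

lemma BoundsIncrements.integral_pos [IsProbabilityMeasure P]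
    (h : BoundsIncrements P σ C c B τ) (hσ : 0 < σ) : 0 < ∫ ω, (τ ω).toReal ∂P := by
  rw [integral_pos_iff_support_of_nonneg (fun ω ↦ ENNReal.toReal_nonneg)
    ((h.memLp_toReal hσ).integrable one_le_two)]
  have : ∀ᵐ ω ∂P, ω ∈ Function.support fun ω ↦ (τ ω).toReal := by
    filter_upwards [h.ae_lt_top hσ, h.pos] with ω h1 h2
    exact (ENNReal.toReal_pos h2.ne' h1.ne).ne'
  rw [measure_congr (Filter.eventuallyEq_univ.2 this : Function.support _ =ᵐ[P] univ)]
  simp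

/-- Zero variance would make `τ` almost surely equal to its mean `e > 0`, but `τ ≤ e / 2` has
positive probability. -/
lemma BoundsIncrements.variance_pos [IsProbabilityMeasure P]
    (h : BoundsIncrements P σ C c B τ) (hσ : 0 < σ) :
    0 < variance (fun ω ↦ (τ ω).toReal) P := by
  refine (variance_nonneg _ _).lt_of_ne' fun h0 ↦ ?_
  have hae := ae_eq_integral_of_variance_eq_zero (h.memLp_toReal hσ) h0
  set e := ∫ ω, (τ ω).toReal ∂P
  have he : 0 < e := h.integral_pos hσ
  refine (h.measure_le_pos hσ (t := (e / 2).toNNReal) (by simpa using he)).ne' ?_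
  refine (ae_iff (p := fun ω ↦ ¬ τ ω ≤ (e / 2).toNNReal)).1 ?_ |> fun h ↦ by simpa using h
  filter_upwards [hae, h.ae_lt_top hσ] with ω h1 h2 hle
  have := ENNReal.toReal_mono ENNReal.coe_ne_top hle
  rw [h1, ENNReal.coe_toReal, Real.coe_toNNReal _ (by positivity)] at this
  linarith

end

/-! ### Scaling and transport of the normalized statistics -/

section

variable {Ω : Type*} [MeasurableSpace Ω] {P : Measure Ω}

/-- Integrability plays no role: default values of integrals and quotients scale consistently, which
covers `σ = 0`. -/
lemma normalizedMoment_const_mul {c : ℝ} (hc : c ≠ 0) (Y : Ω → ℝ) (m : ℕ) :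
    normalizedMoment P (fun ω ↦ c * Y ω) m = normalizedMoment P Y m := by
  simp only [normalizedMoment, moment_def, Pi.pow_apply, mul_pow, integral_const_mul]
  exact mul_div_mul_left _ _ (pow_ne_zero m hc)

lemma coeffVariation_const_mul {c : ℝ} (hc : 0 < c) (Y : Ω → ℝ) :
    coeffVariation P (fun ω ↦ c * Y ω) = coeffVariation P Y := by
  simp only [coeffVariation, variance_const_mul, integral_const_mul]
  rw [Real.sqrt_mul (sq_nonneg c), Real.sqrt_sq hc.le]
  exact mul_div_mul_left _ _ hc.ne'

lemma standardizedMoment_const_mul {c : ℝ} (hc : 0 < c) (Y : Ω → ℝ) (m : ℕ) :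
    standardizedMoment P (fun ω ↦ c * Y ω) m = standardizedMoment P Y m := by
  simp only [standardizedMoment, centralMoment, variance_const_mul, integral_const_mul,
    Pi.pow_apply, Pi.sub_apply, ← mul_sub, mul_pow]
  rw [Real.sqrt_mul (sq_nonneg c), Real.sqrt_sq hc.le, mul_pow]
  exact mul_div_mul_left _ _ (pow_ne_zero m hc.ne')

variable {E : Type*} [MeasurableSpace E] {ν : Measure E} {T : Ω → E} {g : E → ℝ}

lemma ProbabilityTheory.HasLaw.normalizedMoment_comp (h : HasLaw T ν P) (hg : Measurable g)
    (m : ℕ) : normalizedMoment P (fun ω ↦ g (T ω)) m = normalizedMoment ν g m := by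
  have h1 := h.integral_comp (f := fun x ↦ g x ^ m) (by fun_prop)
  have h2 := h.integral_comp (f := g) (by fun_prop)
  simp only [Function.comp_def] at h1 h2
  simp only [normalizedMoment, moment_def, Pi.pow_apply, h1, h2]

lemma ProbabilityTheory.HasLaw.variance_comp (h : HasLaw T ν P) (hg : Measurable g) :
    variance (fun ω ↦ g (T ω)) P = variance g ν := by
  rw [← h.map_eq, variance_map hg.aemeasurable h.aemeasurable, Function.comp_def]

lemma ProbabilityTheory.HasLaw.coeffVariation_comp (h : HasLaw T ν P) (hg : Measurable g) :
    coeffVariation P (fun ω ↦ g (T ω)) = coeffVariation ν g := by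
  have h2 := h.integral_comp (f := g) (by fun_prop)
  simp only [Function.comp_def] at h2
  simp only [coeffVariation, h.variance_comp hg, h2]

lemma ProbabilityTheory.HasLaw.standardizedMoment_comp (h : HasLaw T ν P) (hg : Measurable g)
    (m : ℕ) : standardizedMoment P (fun ω ↦ g (T ω)) m = standardizedMoment ν g m := by
  have h2 := h.integral_comp (f := g) (by fun_prop)
  have h1 := h.integral_comp (f := fun x ↦ (g x - ∫ y, g y ∂ν) ^ m) (by fun_prop)
  simp only [Function.comp_def] at h1 h2
  simp only [standardizedMoment, centralMoment, h.variance_comp hg, Pi.pow_apply, Pi.sub_apply,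
    h1, h2]

/-- The law of any one passage time serves for all others. If none exists, the claim is vacuous and
a Dirac mass will do, so no Brownian motion has to be constructed. -/
lemma exists_law_rescaled_passageTime (k : Thresholds) (σ a b x₀ : ℝ) :
    ∃ ν : Measure ℝ≥0∞, IsProbabilityMeasure ν ∧
      ∀ (θ : ℝ), 0 < θ → ∀ (Ω : Type u) [MeasurableSpace Ω] (P : Measure Ω)
        [IsProbabilityMeasure P] (τ : Ω → ℝ≥0∞), IsOUFirstPassageTime P k θ σ a b x₀ τ →
        HasLaw (fun ω ↦ ENNReal.ofReal θ * τ ω) ν P := by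
  by_cases h : ∃ (θ : ℝ) (Ω : Type u) (_ : MeasurableSpace Ω) (P : Measure Ω) (τ : Ω → ℝ≥0∞),
      0 < θ ∧ IsProbabilityMeasure P ∧ IsOUFirstPassageTime P k θ σ a b x₀ τ
  · obtain ⟨θ, Ω, _, P, τ, hθ, _, hτ⟩ := h
    exact ⟨_, Measure.isProbabilityMeasure_map (hτ.aemeasurable hθ), fun θ' hθ' Ω' _ P' _ τ' hτ' ↦
      ⟨hτ'.aemeasurable hθ', hτ'.map_eq_map hθ' hθ hτ⟩⟩
  · exact ⟨.dirac 0, inferInstance, fun θ hθ Ω _ P _ τ hτ ↦ (h ⟨θ, Ω, _, P, τ, hθ, ‹_›, hτ⟩).elim⟩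

end

theorem mainTheorem1 (k : Thresholds) (σ a b x₀ : ℝ) (hσ : 0 ≤ σ) (hx₀ : x₀ ∈ Ioo a b) :
    -- the law `ν` of the rescaled time `θ τ` depends on `k, σ, a, b, x₀`, but not on `θ`
    ∃ ν : Measure ℝ≥0∞, IsProbabilityMeasure ν ∧
      ∀ (θ : ℝ), 0 < θ → ∀ (Ω : Type u) [MeasurableSpace Ω] (P : Measure Ω)
        [IsProbabilityMeasure P] (τ : Ω → ℝ≥0∞), IsOUFirstPassageTime P k θ σ a b x₀ τ →
        HasLaw (fun ω ↦ ENNReal.ofReal θ * τ ω) ν P ∧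
        -- `E[τ ^ m] = θ ^ (-m) * E[(θ τ) ^ m]`, as an equality in `[0, ∞]`
        (∀ m : ℕ, ∫⁻ ω, τ ω ^ m ∂P = (ENNReal.ofReal θ)⁻¹ ^ m * ∫⁻ t, t ^ m ∂ν) ∧
        -- the normalized statistics are those of `ν`
        (∀ m : ℕ, normalizedMoment P (fun ω ↦ (τ ω).toReal) m =
          normalizedMoment ν ENNReal.toReal m) ∧
        coeffVariation P (fun ω ↦ (τ ω).toReal) = coeffVariation ν ENNReal.toReal ∧
        (∀ m : ℕ, standardizedMoment P (fun ω ↦ (τ ω).toReal) m =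
          standardizedMoment ν ENNReal.toReal m) ∧
        -- for `σ > 0` all these quantities are finite and well defined
        (0 < σ →
          (∀ᵐ ω ∂P, τ ω < ∞) ∧
          (∀ m : ℕ, ∫⁻ ω, τ ω ^ m ∂P < ∞) ∧
          0 < ∫ ω, (τ ω).toReal ∂P ∧
          0 < variance (fun ω ↦ (τ ω).toReal) P) := by
  obtain ⟨ν, hν, hlaw⟩ := exists_law_rescaled_passageTime.{u} k σ a b x₀
  refine ⟨ν, hν, fun θ hθ Ω _ P _ τ hτ ↦ ?_⟩
  have hT := hlaw θ hθ Ω P τ hτ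
  have hθ0 : ENNReal.ofReal θ ≠ 0 := by simpa using hθ
  have hmom (m : ℕ) : ∫⁻ ω, τ ω ^ m ∂P = (ENNReal.ofReal θ)⁻¹ ^ m * ∫⁻ t, t ^ m ∂ν := by
    rw [← hT.lintegral_comp (f := fun t ↦ t ^ m) (by fun_prop)]
    simp_rw [mul_pow]
    rw [lintegral_const_mul' _ _ (by simp), ← mul_assoc, ← mul_pow,
      ENNReal.inv_mul_cancel hθ0 ENNReal.ofReal_ne_top, one_pow, one_mul]
  have hreal (ω : Ω) : (ENNReal.ofReal θ * τ ω).toReal = θ * (τ ω).toReal := by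
    rw [ENNReal.toReal_mul, ENNReal.toReal_ofReal hθ.le]
  have hg := ENNReal.measurable_toReal
  refine ⟨hT, hmom, fun m ↦ ?_, ?_, fun m ↦ ?_, fun hσ' ↦ ?_⟩
  · rw [← hT.normalizedMoment_comp hg]
    simp_rw [hreal]
    exact (normalizedMoment_const_mul hθ.ne' _ m).symm
  · rw [← hT.coeffVariation_comp hg]
    simp_rw [hreal]
    exact (coeffVariation_const_mul hθ _).symm
  · rw [← hT.standardizedMoment_comp hg]
    simp_rw [hreal]
    exact (standardizedMoment_const_mul hθ _ m).symm
  · obtain ⟨C, c, B, hB⟩ := hτ.exists_boundsIncrements hθ hx₀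
    have hmean := hB.integral_pos hσ'
    have hvar := hB.variance_pos hσ'
    simp_rw [hreal] at hmean hvar
    rw [integral_const_mul] at hmean
    rw [variance_const_mul] at hvar
    refine ⟨?_, fun m ↦ ?_, pos_of_mul_pos_right hmean hθ.le,
      pos_of_mul_pos_right hvar (sq_nonneg θ)⟩
    · filter_upwards [hB.ae_lt_top hσ'] with ω hω
      exact ENNReal.lt_top_of_mul_ne_top_right hω.ne hθ0
    · rw [hmom, ← hT.lintegral_comp (f := fun t ↦ t ^ m) (by fun_prop)]
      exact ENNReal.mul_lt_top (ENNReal.pow_lt_top (ENNReal.inv_lt_top.2 (pos_iff_ne_zero.2 hθ0)))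
        (hB.lintegral_pow_lt_top hσ' m)
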